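/- Let $(\Omega,\mathcal F,\mathbb P)$ be a probability space, let $\mathcal U$ and $X$ be real separable Hilbert spaces, and let $\{\dot W(h):h\in\mathcal U\}$ be a zero-mean Gaussian family with $\mathbb E(\dot W(h_1)\dot W(h_2))=(h_1,h_2)_{\mathcal U}$ that generates $\mathcal F$ up to $\mathbb P$-null sets. Let $\{\mathfrak u_k\}$ be an orthonormal basis of $\mathcal U$ and $\xi_k=\dot W(\mathfrak u_k)$. For a multi-index $\alpha=(\alpha_k)$ of non-negative integers with finitely many non-zero entries, put $\alpha!=\prod_k\alpha_k!$ and $$\xi_\alpha=\prod_k \frac{H_{\alpha_k}(\xi_k)}{\sqrt{\alpha_k!}},\qquad H_n(x)=(-1)^ne^{x^2/2}\frac{d^n}{dx^n}e^{-x^2/2},$$ and for square-integrable $\eta$ (real- or $X$-valued) put $\eta_\alpha=\mathbb E(\eta\,\xi_\alpha)$; such an $\eta$ is identified with the formal series $\sum_\alpha\eta_\alpha\xi_\alpha$. Denote by $\varepsilon_k$ the multi-index whose only non-zero entry is a $1$ at place $k$. The Wick product of formal series with coefficients $f_\alpha\in X$ and $g_\alpha\in\mathbb R$ is $$\Big(\sum_{\alpha}f_\alpha\xi_\alpha\Big)\diamond\Big(\sum_{\alpha}g_\alpha\xi_\alpha\Big)=\sum_\alpha\Big(\sum_{\beta+\gamma=\alpha}\sqrt{\frac{\alpha!}{\beta!\,\gamma!}}\,f_\beta\,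 g_\gamma\Big)\xi_\alpha .$$ Let $\mathbf D$, with domain $\mathbb D^{1,2}$, be the Malliavin derivative: the closure, as an operator from $L_2(\Omega)$ to $L_2(\Omega;\mathcal U)$, of $$F(\dot W(h_1),\dots,\dot W(h_n))\mapsto\sum_{i=1}^n\partial_iF(\dot W(h_1),\dots,\dot W(h_n))\,h_i,$$ where $F:\mathbb R^n\to\mathbb R$ is smooth and $F$ and all its derivatives have at most polynomial growth. Let $X\otimes\mathcal U$ be the Hilbert space tensor product. An element $f\in L_2(\Omega;X\otimes\mathcal U)$ is in the domain of the Skorokhod integral $\boldsymbol\delta$, with value $\boldsymbol\delta(f)\in L_2(\Omega;X)$, if $\mathbb E(\varphi\,\boldsymbol\delta(f))=\mathbb E\,(f,\mathbf D\varphi)_{\mathcal U}$ for all $\varphi\in\mathbb D^{1,2}$. **Theorem.** Let $f=\sum_k f_k\otimes\mathfrak u_k$ (convergent in $L_2(\Omega;X\otimes\mathcal U)$) with $f_k\in L_2(\Omega;X)$, $f_k=\sum_\alpha f_{k,\alpha}\xi_\alpha$, be in the domain of $\boldsymbol\delta$. Then $$\boldsymbol\delta(f)=\sum_k f_k\diamond\xi_k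 .$$ That is, in the formal series on the right each coefficient is a sum with finitely many non-zero terms, and the resulting series $\sum_\alpha S_\alpha\xi_\alpha$ converges unconditionally to $\boldsymbol\delta(f)$ in $L_2(\Omega;X)$. Moreover, for every multi-index $\alpha$, $$(\boldsymbol\delta(f))_\alpha=\sum_k\sqrt{\alpha_k}\,f_{k,\alpha-\varepsilon_k},$$ where the terms with $\alpha_k=0$ are zero by convention. -/

import Mathlib

open MeasureTheory ProbabilityTheory Filter
open scoped TensorProduct ENNReal Topology

namespace WienerChaos

/-! ### The Hilbert space tensor product and the partial inner product -/

section Tensor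

variable {X U : Type*} [NormedAddCommGroup X] [InnerProductSpace ℝ X]
  [NormedAddCommGroup U] [InnerProductSpace ℝ U]

/-- The Hilbert space tensor product of `X` and `U`: the completion of the algebraic tensor product
with respect to the inner product with `⟪x ⊗ u, y ⊗ v⟫ = ⟪x, y⟫ * ⟪u, v⟫`. -/
abbrev HTensor (X U : Type*) [NormedAddCommGroup X] [InnerProductSpace ℝ X]
    [NormedAddCommGroup U] [InnerProductSpace ℝ U] : Type _ :=
  UniformSpace.Completion (X ⊗[ℝ] U)

/-- The bounded linear map `x ↦ x ⊗ u` from `X` to the Hilbert space tensor product. -/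
noncomputable def tensorRight (u : U) : X →L[ℝ] HTensor X U :=
  UniformSpace.Completion.toComplL.comp
    (LinearMap.mkContinuous ((TensorProduct.mk ℝ X U).flip u) ‖u‖ (fun x => by
      simp [TensorProduct.norm_tmul, mul_comm]))

@[simp]
theorem tensorRight_apply (x : X) (u : U) :
    tensorRight u x = ((x ⊗ₜ[ℝ] u : X ⊗[ℝ] U) : HTensor X U) := rfl

/-- The partial inner product `(t, u)_U`, an element of `X`, for `t` in the Hilbert space tensor
product of `X` and `U` and `u` in `U`: it is determined by `⟪x, (t, u)_U⟫ = ⟪x ⊗ u, t⟫` for all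
`x` in `X`. -/
noncomputable def partialInner [CompleteSpace X] (t : HTensor X U) (u : U) : X :=
  ContinuousLinearMap.adjoint (tensorRight (X := X) u) t

theorem inner_partialInner [CompleteSpace X] (t : HTensor X U) (u : U) (x : X) :
    inner ℝ x (partialInner t u) = inner ℝ ((x ⊗ₜ[ℝ] u : X ⊗[ℝ] U) : HTensor X U) t := by
  rw [partialInner, ContinuousLinearMap.adjoint_inner_right, tensorRight_apply]

theorem partialInner_tmul [CompleteSpace X] (x : X) (v u : U) :
    partialInner ((x ⊗ₜ[ℝ] v : X ⊗[ℝ] U) : HTensor X U) u = (inner ℝ u v : ℝ) • x := by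
  refine ext_inner_left ℝ fun y => ?_
  rw [inner_partialInner, UniformSpace.Completion.inner_coe, TensorProduct.inner_tmul,
    real_inner_smul_right, mul_comm]

end Tensor

/-! ### Gaussian white noise -/

section Noise

variable {Ω U : Type*} [MeasurableSpace Ω] [NormedAddCommGroup U] [InnerProductSpace ℝ U]

/-- `W` is a zero-mean Gaussian family indexed by `U`, with `E (W h₁ * W h₂) = ⟪h₁, h₂⟫`, that
generates the σ-algebra of the probability space up to null sets. -/
structure IsGaussianNoise (W : U → Ω → ℝ) (P : Measure Ω) : Prop where
  measurable : ∀ h, Measurable (W h)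
  gaussian : IsGaussianProcess W P
  mean_zero : ∀ h, ∫ ω, W h ω ∂P = 0
  covariance : ∀ h₁ h₂, ∫ ω, W h₁ ω * W h₂ ω ∂P = inner ℝ h₁ h₂
  generates : ∀ s : Set Ω, MeasurableSet s →
    ∃ t : Set Ω, MeasurableSet[⨆ h : U, (borel ℝ).comap (W h)] t ∧ s =ᵐ[P] t

/-! ### Malliavin derivative and Skorokhod integral -/

/-- The pairs `(φ, ψ)` with `φ = F (W h₁, …, W hₙ)` and `ψ = ∑ i, ∂ᵢF (W h₁, …, W hₙ) hᵢ`, where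
`F` is smooth and `F` and all its derivatives have at most polynomial growth. -/
def smoothGraph (P : Measure Ω) (W : U → Ω → ℝ) : Set (Lp ℝ 2 P × Lp U 2 P) :=
  {p | ∃ (n : ℕ) (h : Fin n → U) (F : (Fin n → ℝ) → ℝ), Function.HasTemperateGrowth F ∧
    (p.1 =ᵐ[P] fun ω => F (fun i => W (h i) ω)) ∧
    (p.2 =ᵐ[P] fun ω => ∑ i, fderiv ℝ F (fun j => W (h j) ω) (Pi.single i 1) • h i)}

/-- `IsMalliavinDeriv P W φ ψ`: the random variable `φ` is in the domain `𝔻^{1,2}` of the Malliavin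
derivative `D`, and `D φ = ψ`. The operator `D` is the closure in `L₂` of its restriction to smooth
random variables. -/
def IsMalliavinDeriv (P : Measure Ω) (W : U → Ω → ℝ) (φ : Lp ℝ 2 P) (ψ : Lp U 2 P) : Prop :=
  (φ, ψ) ∈ closure (smoothGraph P W)

variable {X : Type*} [NormedAddCommGroup X] [InnerProductSpace ℝ X] [CompleteSpace X]

/-- `IsSkorokhodIntegral P W f v`: the element `f` of `L₂(Ω; X ⊗ U)` is in the domain of the
Skorokhod integral `δ`, and `δ f = v`, that is, `v` is in `L₂(Ω; X)` and
`E (φ v) = E (f, D φ)_U` for all `φ` in the domain of the Malliavin derivative. -/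
def IsSkorokhodIntegral (P : Measure Ω) (W : U → Ω → ℝ) (f : Lp (HTensor X U) 2 P)
    (v : Lp X 2 P) : Prop :=
  ∀ (φ : Lp ℝ 2 P) (Dφ : Lp U 2 P), IsMalliavinDeriv P W φ Dφ →
    ∫ ω, φ ω • v ω ∂P = ∫ ω, partialInner (f ω) (Dφ ω) ∂P

end Noise

/-! ### Chaos expansion -/

section Chaos

variable {Ω U ι X : Type*} [MeasurableSpace Ω] [NormedAddCommGroup U] [InnerProductSpace ℝ U]
  [NormedAddCommGroup X] [InnerProductSpace ℝ X]

/-- The random variable `ξ_α = ∏ k, H_{α_k}(ξ_k) / √(α_k!)`, where `ξ_k = W (u_k)` and `H_n` is the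
(probabilists') Hermite polynomial. -/
noncomputable def xi (W : U → Ω → ℝ) (u : HilbertBasis ι ℝ U) (α : ι →₀ ℕ) (ω : Ω) : ℝ :=
  α.prod fun k n => Polynomial.aeval (W (u k) ω) (Polynomial.hermite n) / √(n.factorial : ℝ)

/-- The chaos coefficients `η_α = E (η ξ_α)` of a square-integrable random element `η`. -/
noncomputable def chaosCoeff (P : Measure Ω) (W : U → Ω → ℝ) (u : HilbertBasis ι ℝ U)
    (η : Ω → X) (α : ι →₀ ℕ) : X :=
  ∫ ω, xi W u α ω • η ω ∂P

/-- `η = ∑ α, c_α ξ_α`, with (unconditional) convergence in `L₂(Ω; X)`. -/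
def HasChaosExpansion (P : Measure Ω) (W : U → Ω → ℝ) (u : HilbertBasis ι ℝ U)
    (c : (ι →₀ ℕ) → X) (η : Ω → X) : Prop :=
  Tendsto (fun S : Finset (ι →₀ ℕ) => eLpNorm (fun ω => η ω - ∑ α ∈ S, xi W u α ω • c α) 2 P)
    atTop (𝓝 0)

/-- `α! = ∏ k, α_k!`. -/
def multiFactorial (α : ι →₀ ℕ) : ℕ := α.prod fun _ n => n.factorial

open Classical in
/-- The Wick product of the formal series `∑ α, f_α ξ_α` (with coefficients in `X`) and
`∑ α, g_α ξ_α` (with real coefficients); formal series are given by their coefficients. -/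
noncomputable def wick (f : (ι →₀ ℕ) → X) (g : (ι →₀ ℕ) → ℝ) (α : ι →₀ ℕ) : X :=
  ∑ p ∈ Finset.HasAntidiagonal.antidiagonal α,
    (√((multiFactorial α : ℝ) / (multiFactorial p.1 * multiFactorial p.2)) * g p.2) • f p.1

/-- The formal series `S` is the sum of the formal series `F k`: for every multi-index, only
finitely many of the `F k` contribute, and the contributions add up to the coefficient of `S`. -/
def IsFormalSum (F : ι → (ι →₀ ℕ) → X) (S : (ι →₀ ℕ) → X) : Prop :=
  ∀ α, (Function.support fun k => F k α).Finite ∧ ∑ᶠ k, F k α = S α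

end Chaos

end WienerChaos

/-! The coefficient formula is the duality defining `δ`, tested on `φ = ξ_α`. Since `H_n' = n
H_{n-1}`, the variable `ξ_α` is a smooth function of finitely many `ξ_k`, with `D ξ_α = ∑ k, √α_k
ξ_{α-ε_k} u_k`. Pairing with `f = ∑ f_k ⊗ u_k` leaves `∑ k, √α_k E(ξ_{α-ε_k} f_k)`, a sum over the
support of `α` (`chaosCoeff_skorokhod`). Wick multiplication by `ξ_k` sends the coefficients `c` to
`√α_k c_{α-ε_k}` (`wick_basis`), so the formal sum of the `f_k ⋄ ξ_k` has exactly the coefficients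
of `δ f`.

Convergence is then the Cameron–Martin theorem (`hasChaosExpansion`): the `ξ_α` are orthonormal and
complete. Orthonormality follows from independence of the `ξ_k` and Hermite orthogonality. For
completeness, a real `η` orthogonal to every `ξ_α` is orthogonal to all powers of finite
combinations of the `ξ_k`, hence to their imaginary exponentials, hence by density to every `exp(i W
h)`. The measures with densities `η⁺` and `η⁻` thus give the noise the same characteristic
functions, and they agree because the noise generates the σ-algebra. Values in `X` reduce to this
through inner products. -/

namespace WienerChaos

/-! ### Hermite polynomials under the standard Gaussian -/

section Hermite

open Polynomial

theorem derivative_hermite_succ (n : ℕ) :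
    derivative (hermite (n + 1)) = ((n : ℤ[X]) + 1) * hermite n := by
  induction n with
  | zero => simp
  | succ n ih =>
    rw [hermite_succ (n + 1), derivative_sub, derivative_mul, ih, derivative_X, derivative_mul]
    rw [hermite_succ n]
    simp only [derivative_add, derivative_natCast, derivative_one]
    push_cast
    ring

theorem derivative_hermite (n : ℕ) :
    derivative (hermite n) = (n : ℤ[X]) * hermite (n - 1) := by
  cases n with
  | zero => simp
  | succ n => rw [derivative_hermite_succ]; simp

theorem integrable_polynomial_gaussianReal (p : ℝ[X]) :
    Integrable (fun x => p.eval x) (gaussianReal 0 1) := by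
  induction p using Polynomial.induction_on' with
  | add p q hp hq => simpa only [eval_add] using! hp.add hq
  | monomial n a =>
    simp only [eval_monomial]
    refine Integrable.const_mul ?_ a
    have := (memLp_id_gaussianReal (μ := 0) (v := 1) (n : NNReal)).integrable_norm_pow' (p := n)
    refine (integrable_norm_iff (by fun_prop)).1 ?_
    simpa using this

theorem integrable_polynomial_mul_gaussianPDFReal (p : ℝ[X]) :
    Integrable (fun x => gaussianPDFReal 0 1 x * p.eval x) := by
  have h := integrable_polynomial_gaussianReal p
  rw [gaussianReal_of_var_ne_zero _ one_ne_zero,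
    integrable_withDensity_iff_integrable_smul' (measurable_gaussianPDF 0 1)
      (ae_of_all _ fun _ => gaussianPDF_lt_top)] at h
  simpa [toReal_gaussianPDF] using h

theorem hasDerivAt_gaussianPDFReal (x : ℝ) :
    HasDerivAt (gaussianPDFReal 0 1) (-x * gaussianPDFReal 0 1 x) x := by
  have h : HasDerivAt (fun y : ℝ => -(y - 0) ^ 2 / (2 * ((1 : NNReal) : ℝ))) (-x) x := by
    have := (((hasDerivAt_id x).sub_const 0).pow 2).neg.div_const (2 * ((1 : NNReal) : ℝ))
    refine this.congr_deriv ?_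
    simp
    ring
  have := (h.exp).const_mul ((√(2 * Real.pi * ((1 : NNReal) : ℝ)))⁻¹)
  rw [gaussianPDFReal_def]
  refine this.congr_deriv ?_
  ring

/-- Gaussian integration by parts for polynomials. -/
theorem integral_X_mul_gaussianReal (p : ℝ[X]) :
    ∫ x, x * p.eval x ∂(gaussianReal 0 1) = ∫ x, (derivative p).eval x ∂(gaussianReal 0 1) := by
  -- With `ρ` the Gaussian density, `ρ' = -xρ`, so the integrand is the derivative of the integrable
  -- function `ρ p`.
  have h0 : ∫ x : ℝ, gaussianPDFReal 0 1 x * (derivative p - X * p).eval x = 0 := by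
    refine integral_eq_zero_of_hasDerivAt_of_integrable
      (f := fun x => gaussianPDFReal 0 1 x * p.eval x) (fun x => ?_)
      (integrable_polynomial_mul_gaussianPDFReal _) (integrable_polynomial_mul_gaussianPDFReal _)
    refine ((hasDerivAt_gaussianPDFReal x).mul (p.hasDerivAt x)).congr_deriv ?_
    simp
    ring
  have h1 : ∫ x, (derivative p - X * p).eval x ∂(gaussianReal 0 1) = 0 := by
    rw [integral_gaussianReal_eq_integral_smul one_ne_zero]
    simpa using h0
  have h2 := integral_sub (integrable_polynomial_gaussianReal (derivative p))
    (integrable_polynomial_gaussianReal (X * p))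
  simp only [← eval_sub] at h2
  rw [h1] at h2
  simp only [eval_mul, eval_X] at h2
  linarith

theorem aeval_eq_eval_map (p : ℤ[X]) (x : ℝ) :
    aeval x p = (p.map (Int.castRingHom ℝ)).eval x := by
  rw [eval_map, aeval_def]
  rfl

/-- The recursion `H_{n+1} = x H_n - H_n'` says that `H_{n+1}` arises from `H_n` by the Gaussian
adjoint of differentiation. Iterating it lowers both indices and yields orthogonality. -/
theorem integral_hermite_succ_mul (n : ℕ) (q : ℝ[X]) :
    ∫ x, aeval x (hermite (n + 1)) * q.eval x ∂(gaussianReal 0 1) =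
      ∫ x, aeval x (hermite n) * (derivative q).eval x ∂(gaussianReal 0 1) := by
  set r : ℝ[X] := (hermite n).map (Int.castRingHom ℝ) with hr
  have e : ∀ x : ℝ, aeval x (hermite n) = r.eval x := aeval_eq_eval_map _
  have e' : ∀ x : ℝ, aeval x (hermite (n + 1)) = x * r.eval x - (derivative r).eval x := fun x => by
    rw [hermite_succ, map_sub, map_mul, aeval_X, e, hr, derivative_map, aeval_eq_eval_map]
  simp only [e, e', sub_mul]
  have h := integral_X_mul_gaussianReal (r * q)
  have i1 := integrable_polynomial_gaussianReal (X * (r * q))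
  have i2 := integrable_polynomial_gaussianReal (derivative r * q)
  have i3 := integrable_polynomial_gaussianReal (r * derivative q)
  simp only [derivative_mul, eval_add, eval_mul, eval_X] at h i1 i2 i3
  rw [integral_add i2 i3] at h
  simp only [mul_assoc]
  rw [integral_sub i1 i2, h]
  ring

/-- Orthogonality of the Hermite polynomials. -/
theorem integral_hermite_mul_hermite (n m : ℕ) :
    ∫ x, aeval x (hermite n) * aeval x (hermite m) ∂(gaussianReal 0 1) =
      if n = m then (n.factorial : ℝ) else 0 := by
  induction n generalizing m with
  | zero =>
    cases m with
    | zero => simp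
    | succ m =>
      have := integral_hermite_succ_mul m 1
      simpa using this
  | succ n ih =>
    cases m with
    | zero =>
      have := integral_hermite_succ_mul n 1
      simpa using this
    | succ m =>
      have := integral_hermite_succ_mul n ((hermite (m + 1)).map (Int.castRingHom ℝ))
      simp only [← aeval_eq_eval_map] at this
      rw [this, derivative_map, derivative_hermite_succ]
      simp only [Polynomial.map_mul, eval_mul, ← aeval_eq_eval_map, Polynomial.map_add,
        Polynomial.map_natCast, Polynomial.map_one, eval_add, eval_natCast, eval_one]
      simp_rw [mul_left_comm _ ((m : ℝ) + 1)]
      rw [integral_const_mul, ih]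
      by_cases h : n = m
      · subst h
        simp [Nat.factorial_succ]
      · simp [h]

end Hermite

/-! ### Moments of all orders -/

section Moments

variable {Ω : Type*} [MeasurableSpace Ω] {P : Measure Ω}

/-- Products of functions with moments of all orders have moments of all orders. -/
theorem memLp_mul_of_forall {f g : Ω → ℝ} (hf : ∀ p : ℝ≥0∞, p ≠ ∞ → MemLp f p P)
    (hg : ∀ p : ℝ≥0∞, p ≠ ∞ → MemLp g p P) (p : ℝ≥0∞) (hp : p ≠ ∞) :
    MemLp (fun ω => f ω * g ω) p P := by
  have : ENNReal.HolderTriple (p * 2) (p * 2) p := ⟨by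
    rcases eq_or_ne p 0 with rfl | h0
    · simp
    rw [ENNReal.mul_inv (Or.inl h0) (Or.inl hp), ← mul_add, ENNReal.inv_two_add_inv_two, mul_one]⟩
  exact (hg (p * 2) (ENNReal.mul_ne_top hp (by simp))).mul' (hf (p * 2)
    (ENNReal.mul_ne_top hp (by simp)))

theorem memLp_finsetProd_of_forall [IsFiniteMeasure P] {κ : Type*} (s : Finset κ) {f : κ → Ω → ℝ}
    (hf : ∀ k ∈ s, ∀ p : ℝ≥0∞, p ≠ ∞ → MemLp (f k) p P) (p : ℝ≥0∞) (hp : p ≠ ∞) :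
    MemLp (fun ω => ∏ k ∈ s, f k ω) p P := by
  classical
  induction s using Finset.induction_on generalizing p with
  | empty => simpa using memLp_const (1 : ℝ)
  | insert a s ha ih =>
    simp only [Finset.prod_insert ha]
    exact memLp_mul_of_forall (hf a (by simp))
      (fun p hp => ih (fun k hk => hf k (by simp [hk])) p hp) p hp

theorem memLp_polynomial_of_forall [IsFiniteMeasure P] {f : Ω → ℝ}
    (hf : ∀ p : ℝ≥0∞, p ≠ ∞ → MemLp f p P) (q : Polynomial ℝ) (p : ℝ≥0∞) (hp : p ≠ ∞) :
    MemLp (fun ω => q.eval (f ω)) p P := by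
  induction q using Polynomial.induction_on' with
  | add q r hq hr => simpa only [Polynomial.eval_add] using! hq.add hr
  | monomial n a =>
    simp only [Polynomial.eval_monomial]
    have := memLp_finsetProd_of_forall (Finset.range n) (f := fun _ => f) (fun _ _ => hf) p hp
    simp only [Finset.prod_const, Finset.card_range] at this
    exact this.const_mul a

end Moments

/-! ### Independence and linearity of the noise -/

section Noise

variable {Ω U : Type*} [MeasurableSpace Ω] {P : Measure Ω} [NormedAddCommGroup U]
  [InnerProductSpace ℝ U] {W : U → Ω → ℝ}

theorem IsGaussianNoise.memLp (hW : IsGaussianNoise W P) (h : U) (p : ℝ≥0∞) (hp : p ≠ ∞) :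
    MemLp (W h) p P :=
  (hW.gaussian.hasGaussianLaw_eval h).memLp hp

theorem IsGaussianNoise.map_eq (hW : IsGaussianNoise W P) (h : U) :
    P.map (W h) = gaussianReal 0 (‖h‖₊ ^ 2) := by
  rw [(hW.gaussian.hasGaussianLaw_eval h).map_eq_gaussianReal, hW.mean_zero,
    variance_of_integral_eq_zero (hW.measurable h).aemeasurable (hW.mean_zero h)]
  congr 1
  have := hW.covariance h h
  simp only [← pow_two, real_inner_self_eq_norm_sq] at this
  ext
  simp [this]

theorem IsGaussianNoise.covariance_eq [IsProbabilityMeasure P] (hW : IsGaussianNoise W P)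
    (g h : U) : cov[W g, W h; P] = inner ℝ g h := by
  rw [covariance_eq_sub (hW.memLp g 2 (by simp)) (hW.memLp h 2 (by simp)), hW.mean_zero,
    hW.mean_zero, ← hW.covariance]
  simp

theorem IsGaussianNoise.iIndepFun [IsProbabilityMeasure P] (hW : IsGaussianNoise W P)
    {κ : Type*} [Fintype κ] {v : κ → U} (hv : Pairwise fun i j => inner ℝ (v i) (v j) = 0) :
    iIndepFun (fun k => W (v k)) P := by
  refine HasGaussianLaw.iIndepFun_of_covariance_eq_zero ?_
    fun i j hij => by rw [hW.covariance_eq, hv hij]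
  let L : (↥(Finset.univ : Finset κ) → ℝ) →L[ℝ] (κ → ℝ) :=
    ContinuousLinearMap.pi fun k => ContinuousLinearMap.proj
      (⟨k, Finset.mem_univ k⟩ : ↥(Finset.univ : Finset κ))
  exact ((hW.gaussian.comp_right v).hasGaussianLaw Finset.univ).map L

/-- The noise is almost surely linear. -/
theorem IsGaussianNoise.sum_smul_ae_eq (hW : IsGaussianNoise W P) {κ : Type*}
    (s : Finset κ) (c : κ → ℝ) (h : κ → U) :
    W (∑ k ∈ s, c k • h k) =ᵐ[P] fun ω => ∑ k ∈ s, c k * W (h k) ω := by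
  set g := ∑ k ∈ s, c k • h k with hg
  have hi : ∀ a b : U, Integrable (fun ω => W a ω * W b ω) P := fun a b =>
    (hW.memLp a 2 (by simp)).integrable_mul (hW.memLp b 2 (by simp))
  have hmem : MemLp (fun ω => W g ω - ∑ k ∈ s, c k * W (h k) ω) 2 P :=
    (hW.memLp g 2 (by simp)).sub
      (memLp_finsetSum s fun k _ => (hW.memLp (h k) 2 (by simp)).const_mul (c k))
  -- Bilinearity of the covariance makes the difference orthogonal to every `W a` (`e1`). The
  -- difference is itself a combination of such variables, so its second moment vanishes.
  have key : ∫ ω, (W g ω - ∑ k ∈ s, c k * W (h k) ω) ^ 2 ∂P = 0 := by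
    have e1 : ∀ a : U, ∫ ω, W a ω * (W g ω - ∑ k ∈ s, c k * W (h k) ω) ∂P = 0 := fun a => by
      simp only [mul_sub, Finset.mul_sum, mul_left_comm _ (c _)]
      rw [integral_sub (hi _ _) (integrable_finsetSum _ fun k _ => (hi _ _).const_mul _),
        integral_finsetSum _ fun k _ => (hi _ _).const_mul _]
      simp only [integral_const_mul, hW.covariance]
      rw [hg, inner_sum]
      simp [inner_smul_right]
    have hi' : ∀ a : U, Integrable (fun ω => W a ω * (W g ω - ∑ k ∈ s, c k * W (h k) ω)) P :=
      fun a => (hW.memLp a 2 (by simp)).integrable_mul hmem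
    simp only [pow_two]
    nth_rewrite 1 [show (fun ω => (W g ω - ∑ k ∈ s, c k * W (h k) ω) *
        (W g ω - ∑ k ∈ s, c k * W (h k) ω)) = fun ω =>
        W g ω * (W g ω - ∑ k ∈ s, c k * W (h k) ω) - ∑ k ∈ s, c k * (W (h k) ω *
          (W g ω - ∑ k ∈ s, c k * W (h k) ω)) from funext fun ω => by
      rw [sub_mul (W g ω), Finset.sum_mul]
      simp only [mul_assoc]]
    rw [integral_sub (hi' _) (integrable_finsetSum _ fun k _ => (hi' _).const_mul _),
      integral_finsetSum _ fun k _ => (hi' _).const_mul _]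
    simp [integral_const_mul, e1]
  rw [integral_eq_zero_iff_of_nonneg (fun ω => sq_nonneg _) hmem.integrable_sq] at key
  filter_upwards [key] with ω hω
  simpa [sub_eq_zero] using hω

end Noise

/-! ### Orthonormality of the `ξ_α` -/

section Xi

variable {Ω U ι : Type*} [NormedAddCommGroup U] [InnerProductSpace ℝ U] (u : HilbertBasis ι ℝ U)

theorem xi_eq_prod (W : U → Ω → ℝ) {α : ι →₀ ℕ} {s : Finset ι} (hs : α.support ⊆ s) (ω : Ω) :
    xi W u α ω = ∏ k ∈ s,
      Polynomial.aeval (W (u k) ω) (Polynomial.hermite (α k)) / √((α k).factorial : ℝ) :=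
  Finsupp.prod_of_support_subset _ hs _ (by simp)

variable [MeasurableSpace Ω] {P : Measure Ω} {W : U → Ω → ℝ}

theorem IsGaussianNoise.memLp_xi [IsFiniteMeasure P] (hW : IsGaussianNoise W P) (α : ι →₀ ℕ)
    (p : ℝ≥0∞) (hp : p ≠ ∞) : MemLp (xi W u α) p P := by
  refine memLp_finsetProd_of_forall _ (fun k _ p hp => ?_) p hp
  simp only [aeval_eq_eval_map, div_eq_mul_inv]
  exact (memLp_polynomial_of_forall (hW.memLp (u k)) _ p hp).mul_const _

/-- Both products are written over the union of the supports. Independence of the `ξ_k` then factors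
the expectation into one-dimensional Hermite integrals. -/
theorem IsGaussianNoise.integral_xi_mul_xi [IsProbabilityMeasure P] (hW : IsGaussianNoise W P)
    [DecidableEq (ι →₀ ℕ)] (α β : ι →₀ ℕ) :
    ∫ ω, xi W u α ω * xi W u β ω ∂P = if α = β then 1 else 0 := by
  classical
  set s := α.support ∪ β.support with hs
  let F : s → ℝ → ℝ := fun k x => (Polynomial.aeval x (Polynomial.hermite (α k)) /
    √((α k).factorial : ℝ)) * (Polynomial.aeval x (Polynomial.hermite (β k)) /
    √((β k).factorial : ℝ))
  have hF : ∀ k, Measurable (F k) := fun k => by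
    simp only [F, aeval_eq_eval_map]
    fun_prop
  have e1 : ∀ ω, xi W u α ω * xi W u β ω = ∏ k : s, F k (W (u k) ω) := fun ω => by
    rw [xi_eq_prod u W Finset.subset_union_left, xi_eq_prod u W Finset.subset_union_right,
      ← Finset.prod_mul_distrib]
    exact (Finset.prod_coe_sort s fun k => (Polynomial.aeval (W (u k) ω)
      (Polynomial.hermite (α k)) / √((α k).factorial : ℝ)) * (Polynomial.aeval (W (u k) ω)
      (Polynomial.hermite (β k)) / √((β k).factorial : ℝ))).symm
  have e2 : ∀ k : s, ∫ ω, F k (W (u k) ω) ∂P = if α k = β k then 1 else 0 := fun k => by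
    rw [← integral_map (hW.measurable (u k)).aemeasurable (hF k).aestronglyMeasurable, hW.map_eq]
    have hn : ‖u k‖₊ = 1 := by ext; simpa using u.orthonormal.1 k
    rw [hn, one_pow]
    simp only [F, div_mul_div_comm]
    rw [integral_div, integral_hermite_mul_hermite]
    split_ifs with h
    · rw [h, Real.mul_self_sqrt (by positivity), div_self (by positivity)]
    · simp
  simp only [e1]
  rw [(hW.iIndepFun (v := fun k : s => u k) fun i j hij => u.orthonormal.2
    fun h => hij (Subtype.ext h)).integral_fun_prod_comp
    (fun k => (hW.measurable _).aemeasurable) (fun k => (hF k).aestronglyMeasurable)]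
  simp only [e2]
  split_ifs with h
  · simp [h]
  · obtain ⟨k, hk⟩ := DFunLike.ne_iff.1 h
    have hks : k ∈ s := by
      by_contra hk'
      simp only [hs, Finset.mem_union, Finsupp.mem_support_iff, not_or, not_not] at hk'
      exact hk (hk'.1.trans hk'.2.symm)
    exact Finset.prod_eq_zero (Finset.mem_univ ⟨k, hks⟩) (if_neg hk)

end Xi

/-! ### Growth and derivatives of product functions -/

section TemperateGrowth

theorem hasTemperateGrowth_polynomial (p : Polynomial ℝ) :
    Function.HasTemperateGrowth fun x : ℝ => p.eval x := by
  induction p using Polynomial.induction_on' with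
  | add p q hp hq => simpa only [Polynomial.eval_add] using! hp.add hq
  | monomial n a =>
    simp only [Polynomial.eval_monomial]
    fun_prop

theorem hasTemperateGrowth_finsetProd {E κ : Type*} [NormedAddCommGroup E] [NormedSpace ℝ E]
    (s : Finset κ) {f : κ → E → ℝ} (hf : ∀ k ∈ s, (f k).HasTemperateGrowth) :
    Function.HasTemperateGrowth fun x => ∏ k ∈ s, f k x := by
  classical
  induction s using Finset.induction_on with
  | empty => simp
  | insert a s ha ih =>
    simp only [Finset.prod_insert ha]
    exact (hf a (by simp)).mul (ih fun k hk => hf k (by simp [hk]))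

theorem fderiv_prod_apply_single {κ : Type*} [Fintype κ] [DecidableEq κ] {g : κ → ℝ → ℝ}
    (hg : ∀ k, Differentiable ℝ (g k)) (x : κ → ℝ) (i : κ) :
    fderiv ℝ (fun y : κ → ℝ => ∏ k, g k (y k)) x (Pi.single i 1) =
      deriv (g i) (x i) * ∏ k ∈ Finset.univ.erase i, g k (x k) := by
  have h : ∀ k ∈ Finset.univ, HasFDerivAt (fun y : κ → ℝ => g k (y k))
      (deriv (g k) (x k) • ContinuousLinearMap.proj (R := ℝ) (φ := fun _ : κ => ℝ) k) x :=
    fun k _ => (hg k (x k)).hasDerivAt.comp_hasFDerivAt x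
      (ContinuousLinearMap.proj (R := ℝ) (φ := fun _ : κ => ℝ) k).hasFDerivAt
  rw [(HasFDerivAt.finsetProd h).fderiv]
  simp [Pi.single_apply, mul_comm]

end TemperateGrowth

/-! ### The Malliavin derivative of `ξ_α` -/

section XiDeriv

/-- Normalising `H_n' = n H_{n-1}` uses `n / √n! = √n / √(n-1)!`. For `n = 0` the truncated index is
harmless because `√0 = 0`. -/
theorem deriv_hermite_div_sqrt (n : ℕ) (x : ℝ) :
    deriv (fun y : ℝ => Polynomial.aeval y (Polynomial.hermite n) / √(n.factorial : ℝ)) x =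
      √(n : ℝ) * (Polynomial.aeval x (Polynomial.hermite (n - 1)) /
        √((n - 1).factorial : ℝ)) := by
  simp only [aeval_eq_eval_map]
  rw [deriv_div_const, Polynomial.deriv, Polynomial.derivative_map, derivative_hermite]
  cases n with
  | zero => simp
  | succ n =>
    simp only [Polynomial.map_mul, Polynomial.map_natCast, Polynomial.eval_mul,
      Polynomial.eval_natCast, Nat.add_sub_cancel, Nat.factorial_succ, Nat.cast_mul]
    rw [Real.sqrt_mul (by positivity)]
    have h1 : √((n + 1 : ℕ) : ℝ) ≠ 0 := by positivity
    have h2 : √(n.factorial : ℝ) ≠ 0 := by positivity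
    field_simp
    rw [Real.sq_sqrt (by positivity), mul_comm]

variable {Ω U ι : Type*} [NormedAddCommGroup U] [InnerProductSpace ℝ U] (u : HilbertBasis ι ℝ U)

/-- The Malliavin derivative of `ξ_α`. -/
noncomputable def xiDeriv (W : U → Ω → ℝ) (α : ι →₀ ℕ) (ω : Ω) : U :=
  ∑ k ∈ α.support, (√(α k : ℝ) * xi W u (α - Finsupp.single k 1) ω) • u k

/-- Isolates the factor at `k`, so that `ξ_α` and `ξ_{α±ε_k}` share a common cofactor. -/
theorem xi_eq_mul_prod_erase [DecidableEq ι] (W : U → Ω → ℝ) {α β : ι →₀ ℕ} {k : ι}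
    (h : ∀ j, j ≠ k → β j = α j) (ω : Ω) :
    xi W u β ω =
      Polynomial.aeval (W (u k) ω) (Polynomial.hermite (β k)) / √((β k).factorial : ℝ) *
        ∏ j ∈ α.support.erase k,
          Polynomial.aeval (W (u j) ω) (Polynomial.hermite (α j)) / √((α j).factorial : ℝ) := by
  have hs : β.support ⊆ insert k (α.support.erase k) := fun j hj => by
    rcases eq_or_ne j k with rfl | hjk
    · simp
    · rw [Finsupp.mem_support_iff, h j hjk] at hj
      simp [hjk, hj]
  rw [xi_eq_prod u W hs, Finset.prod_insert (Finset.notMem_erase k _)]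
  congr 1
  exact Finset.prod_congr rfl fun j hj => by rw [h j (Finset.ne_of_mem_erase hj)]

theorem xi_tsub_single [DecidableEq ι] (W : U → Ω → ℝ) (α : ι →₀ ℕ) (k : ι) (ω : Ω) :
    xi W u (α - Finsupp.single k 1) ω =
      Polynomial.aeval (W (u k) ω) (Polynomial.hermite (α k - 1)) / √((α k - 1).factorial : ℝ) *
        ∏ j ∈ α.support.erase k,
          Polynomial.aeval (W (u j) ω) (Polynomial.hermite (α j)) / √((α j).factorial : ℝ) := by
  rw [xi_eq_mul_prod_erase u W (α := α) (k := k) fun j hj => by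
    rw [Finsupp.tsub_apply, Finsupp.single_eq_of_ne hj, tsub_zero]]
  simp

variable [MeasurableSpace Ω] {P : Measure Ω} {W : U → Ω → ℝ}

theorem IsGaussianNoise.memLp_xiDeriv [IsFiniteMeasure P] (hW : IsGaussianNoise W P)
    (α : ι →₀ ℕ) : MemLp (xiDeriv u W α) 2 P :=
  memLp_finsetSum _ fun k _ => (ContinuousLinearMap.toSpanSingleton ℝ (u k)).comp_memLp'
    ((hW.memLp_xi u (α - Finsupp.single k 1) 2 (by simp)).const_mul √(α k : ℝ))

/-- The pair lies in the graph of smooth random variables before closure: `ξ_α` is a polynomial in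
the `ξ_k` with `k` in the support of `α`. -/
theorem IsGaussianNoise.isMalliavinDeriv_xi [IsFiniteMeasure P] (hW : IsGaussianNoise W P)
    (α : ι →₀ ℕ) :
    IsMalliavinDeriv P W (hW.memLp_xi u α 2 (by simp)).toLp (hW.memLp_xiDeriv u α).toLp := by
  classical
  refine subset_closure ?_
  let e := α.support.equivFin
  let g : Fin α.support.card → ℝ → ℝ := fun i y =>
    Polynomial.aeval y (Polynomial.hermite (α (e.symm i))) /
      √((α (e.symm i)).factorial : ℝ)
  have hgp : ∀ i, g i = fun y => ((Polynomial.hermite (α (e.symm i))).map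
      (Int.castRingHom ℝ)).eval y / √((α (e.symm i)).factorial : ℝ) := fun i =>
    funext fun y => by simp only [g, aeval_eq_eval_map]
  have hgt : ∀ i, (g i).HasTemperateGrowth := fun i => by
    rw [hgp]
    simp only [div_eq_mul_inv]
    exact (hasTemperateGrowth_polynomial _).mul (.const _)
  refine ⟨α.support.card, fun i => u (e.symm i), fun x => ∏ i, g i (x i),
    hasTemperateGrowth_finsetProd _ fun i _ =>
      (hgt i).comp (ContinuousLinearMap.proj (R := ℝ) (φ := fun _ => ℝ) i).hasTemperateGrowth,
    ?_, ?_⟩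
  · filter_upwards [(hW.memLp_xi u α 2 (by simp)).coeFn_toLp] with ω hω
    rw [hω, xi_eq_prod u W subset_rfl, ← Finset.prod_coe_sort]
    exact Fintype.prod_equiv e _ _ fun k => by simp [g]
  · filter_upwards [(hW.memLp_xiDeriv u α).coeFn_toLp] with ω hω
    rw [hω, xiDeriv, ← Finset.sum_coe_sort]
    refine Fintype.sum_equiv e _ _ fun k => ?_
    rw [fderiv_prod_apply_single fun i => (hgt i).1.differentiable (by simp)]
    simp only [g, deriv_hermite_div_sqrt, Equiv.symm_apply_apply]
    rw [xi_tsub_single, mul_assoc]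
    congr 3
    refine Finset.prod_bij' (fun j hj => e ⟨j, Finset.mem_of_mem_erase hj⟩)
      (fun i _ => (e.symm i : ι)) ?_ ?_ ?_ ?_ ?_
    · intro j hj
      simp only [Finset.mem_erase, Finset.mem_univ, and_true, ne_eq, EmbeddingLike.apply_eq_iff_eq]
      exact fun h => Finset.ne_of_mem_erase hj (congrArg Subtype.val h)
    · intro i hi
      refine Finset.mem_erase.2 ⟨fun h => ?_, (e.symm i).2⟩
      refine Finset.ne_of_mem_erase hi ?_
      rw [← Subtype.ext h, Equiv.apply_symm_apply]
    · simp
    · simp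
    · simp

end XiDeriv

/-! ### Chaos coefficients of the Skorokhod integral -/

section Coefficients

variable {X U : Type*} [NormedAddCommGroup X] [InnerProductSpace ℝ X] [CompleteSpace X]
  [NormedAddCommGroup U] [InnerProductSpace ℝ U]

theorem partialInner_sum_smul {κ : Type*} (t : HTensor X U) (s : Finset κ) (c : κ → ℝ)
    (v : κ → U) :
    partialInner t (∑ k ∈ s, c k • v k) = ∑ k ∈ s, c k • partialInner t (v k) := by
  have h : tensorRight (X := X) (∑ k ∈ s, c k • v k) = ∑ k ∈ s, c k • tensorRight (v k) := by
    ext x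
    simp only [sum_apply, smul_apply, tensorRight_apply,
      TensorProduct.tmul_sum, TensorProduct.tmul_smul]
    rw [← UniformSpace.Completion.coe_toComplL (𝕜 := ℝ)]
    simp only [map_sum, map_smul]
  rw [partialInner, h]
  simp [partialInner]

variable {Ω ι : Type*} [MeasurableSpace Ω] {P : Measure Ω}

/-- The partial inner products of `∑ k, f_k ⊗ u_k` with `u_k` are the `f_k`. -/
theorem partialInner_ae_eq_of_hasSum (u : HilbertBasis ι ℝ U) {f : Lp (HTensor X U) 2 P}
    {fk : ι → Lp X 2 P}
    (hf : HasSum (fun k => (tensorRight (X := X) (u k)).compLp (fk k)) f) (k : ι) :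
    (fun ω => partialInner (f ω) (u k)) =ᵐ[P] fk k := by
  classical
  let A : HTensor X U →L[ℝ] X := ContinuousLinearMap.adjoint (tensorRight (X := X) (u k))
  -- The partial inner product with `u k` is a bounded operator, so it acts termwise on the series;
  -- orthonormality keeps only the term `k`.
  have h1 := (A.compLpL 2 P).hasSum hf
  have h2 : ∀ j, A.compLpL 2 P ((tensorRight (X := X) (u j)).compLp (fk j)) =
      if j = k then fk k else 0 := fun j => by
    refine Lp.ext ?_
    have e1 := A.coeFn_compLp ((tensorRight (X := X) (u j)).compLp (fk j))
    have e2 := (tensorRight (X := X) (u j)).coeFn_compLp (fk j)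
    have e3 := Lp.coeFn_zero X 2 P
    filter_upwards [e1, e2, e3] with ω h1 h2 h3
    change (A.compLp ((tensorRight (X := X) (u j)).compLp (fk j))) ω = _
    rw [h1, h2, tensorRight_apply]
    refine (partialInner_tmul (fk j ω) (u j) (u k)).trans ?_
    rw [orthonormal_iff_ite.1 u.orthonormal]
    rcases eq_or_ne j k with rfl | h
    · simp
    · rw [if_neg h.symm, if_neg h, h3]
      simp
  have h3 : A.compLpL 2 P f = fk k := by
    refine h1.unique ?_
    simp only [h2]
    exact hasSum_ite_eq k (fk k)
  filter_upwards [A.coeFn_compLp f] with ω hω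
  rw [← h3]
  exact hω.symm

theorem chaosCoeff_skorokhod [IsFiniteMeasure P] {W : U → Ω → ℝ} (hW : IsGaussianNoise W P)
    (u : HilbertBasis ι ℝ U) {f : Lp (HTensor X U) 2 P} {fk : ι → Lp X 2 P}
    (hf : HasSum (fun k => (tensorRight (X := X) (u k)).compLp (fk k)) f) {v : Lp X 2 P}
    (hv : IsSkorokhodIntegral P W f v) (α : ι →₀ ℕ) :
    chaosCoeff P W u v α =
      ∑ k ∈ α.support, √(α k : ℝ) • chaosCoeff P W u (fk k) (α - Finsupp.single k 1) := by
  have h := hv _ _ (hW.isMalliavinDeriv_xi u α)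
  have e1 : chaosCoeff P W u v α =
      ∫ ω, (hW.memLp_xi u α 2 (by simp)).toLp _ ω • v ω ∂P := by
    refine integral_congr_ae ?_
    filter_upwards [(hW.memLp_xi u α 2 (by simp)).coeFn_toLp] with ω hω
    rw [hω]
  have e2 : ∫ ω, partialInner (f ω) ((hW.memLp_xiDeriv u α).toLp _ ω) ∂P =
      ∫ ω, ∑ k ∈ α.support, √(α k : ℝ) • xi W u (α - Finsupp.single k 1) ω • fk k ω ∂P := by
    refine integral_congr_ae ?_
    have := (Finset.eventually_all α.support).2 fun k _ => partialInner_ae_eq_of_hasSum u hf k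
    filter_upwards [(hW.memLp_xiDeriv u α).coeFn_toLp, this] with ω hω hk
    rw [hω, xiDeriv, partialInner_sum_smul]
    refine Finset.sum_congr rfl fun k hks => ?_
    rw [hk k hks, mul_smul]
  rw [e1, h, e2, integral_finsetSum]
  · simp only [integral_smul, chaosCoeff]
  · intro k _
    exact ((Lp.memLp (fk k)).smul (hW.memLp_xi u _ 2 (by simp)) (r := 1)).integrable le_rfl
      |>.smul _

end Coefficients

/-! ### Powers of the noise in the span of the `ξ_α` -/

section Span

variable {Ω U ι : Type*} [NormedAddCommGroup U] [InnerProductSpace ℝ U] (u : HilbertBasis ι ℝ U)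

theorem mul_hermite (n : ℕ) (x : ℝ) :
    x * Polynomial.aeval x (Polynomial.hermite n) =
      Polynomial.aeval x (Polynomial.hermite (n + 1)) +
        n * Polynomial.aeval x (Polynomial.hermite (n - 1)) := by
  rw [Polynomial.hermite_succ, derivative_hermite]
  simp

/-- This is the recurrence `x H_n = H_{n+1} + n H_{n-1}` after normalisation. It makes the span of
the `ξ_α` stable under multiplication by `ξ_k`. -/
theorem mul_xi (W : U → Ω → ℝ) (α : ι →₀ ℕ) (k : ι) (ω : Ω) :
    W (u k) ω * xi W u α ω = √(α k + 1 : ℝ) * xi W u (α + Finsupp.single k 1) ω +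
      √(α k : ℝ) * xi W u (α - Finsupp.single k 1) ω := by
  classical
  rw [xi_tsub_single, xi_eq_mul_prod_erase u W (α := α) (k := k) fun _ _ => rfl,
    xi_eq_mul_prod_erase u W (α := α) (β := α + Finsupp.single k 1) (k := k) fun j hj => by
      rw [Finsupp.add_apply, Finsupp.single_eq_of_ne hj, add_zero]]
  simp only [← mul_assoc, ← add_mul]
  congr 1
  rw [mul_div_assoc', mul_hermite]
  simp only [Finsupp.add_apply, Finsupp.single_eq_same]
  have h1 : √((α k + 1).factorial : ℝ) = √(α k + 1 : ℝ) * √((α k).factorial : ℝ) := by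
    rw [Nat.factorial_succ, Nat.cast_mul, Real.sqrt_mul (by positivity)]
    push_cast
    rfl
  have h2 : (α k : ℝ) / √((α k).factorial : ℝ) = √(α k : ℝ) / √((α k - 1).factorial : ℝ) := by
    rcases Nat.eq_zero_or_eq_succ_pred (α k) with h | h
    · simp [h]
    · rw [h, Nat.succ_eq_add_one, Nat.factorial_succ, Nat.cast_mul,
        Real.sqrt_mul (by positivity), Nat.add_sub_cancel]
      nth_rewrite 1 [← Real.mul_self_sqrt (Nat.cast_nonneg' ((α k).pred + 1) (α := ℝ))]
      rw [mul_div_mul_left _ _ (by positivity)]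
  rw [h1, add_div, mul_div_assoc', mul_div_mul_left _ _ (by positivity), mul_div_right_comm, h2]
  ring

theorem mul_mem_span_xi (W : U → Ω → ℝ) (k : ι) {q : Ω → ℝ}
    (hq : q ∈ Submodule.span ℝ (Set.range (xi W u))) :
    W (u k) * q ∈ Submodule.span ℝ (Set.range (xi W u)) := by
  induction hq using Submodule.span_induction with
  | mem q hq =>
    obtain ⟨α, rfl⟩ := hq
    rw [show W (u k) * xi W u α = √(α k + 1 : ℝ) • xi W u (α + Finsupp.single k 1) +
      √(α k : ℝ) • xi W u (α - Finsupp.single k 1) from funext fun ω => mul_xi u W α k ω]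
    exact add_mem (Submodule.smul_mem _ _ (Submodule.subset_span ⟨_, rfl⟩))
      (Submodule.smul_mem _ _ (Submodule.subset_span ⟨_, rfl⟩))
  | zero => simp
  | add p q _ _ hp hq => rw [mul_add]; exact add_mem hp hq
  | smul c q _ hq => rw [mul_smul_comm]; exact Submodule.smul_mem _ _ hq

theorem sum_pow_mem_span_xi (W : U → Ω → ℝ) (s : Finset ι) (c : ι → ℝ) (n : ℕ) :
    (∑ k ∈ s, c k • W (u k)) ^ n ∈ Submodule.span ℝ (Set.range (xi W u)) := by
  induction n with
  | zero =>
    refine Submodule.subset_span ⟨0, ?_⟩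
    ext ω
    simp [xi]
  | succ n ih =>
    rw [pow_succ', Finset.sum_mul]
    refine sum_mem fun k _ => ?_
    rw [smul_mul_assoc]
    exact Submodule.smul_mem _ _ (mul_mem_span_xi u W k ih)

end Span

/-! ### Orthogonality to the imaginary exponentials -/

section CharFun

variable {Ω U : Type*} [MeasurableSpace Ω] {P : Measure Ω}
  [NormedAddCommGroup U] [InnerProductSpace ℝ U] {W : U → Ω → ℝ}

theorem IsGaussianNoise.memLp_exp_abs (hW : IsGaussianNoise W P) (h : U) :
    MemLp (fun ω => Real.exp |W h ω|) 2 P := by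
  have hm := hW.measurable h
  have hint : ∀ t : ℝ, Integrable (fun ω => Real.exp (t * W h ω)) P := fun t => by
    have := integrable_exp_mul_gaussianReal (μ := 0) (v := ‖h‖₊ ^ 2) t
    rw [← hW.map_eq h, integrable_map_measure (by fun_prop) hm.aemeasurable] at this
    exact this
  rw [memLp_two_iff_integrable_sq (by fun_prop)]
  refine (integrable_exp_mul_abs (hint 2) (hint (-2))).congr (ae_of_all _ fun ω => ?_)
  simp only [← Real.exp_nat_mul]
  norm_num

theorem IsGaussianNoise.integral_sub_sq (hW : IsGaussianNoise W P) (g h : U) :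
    ∫ ω, (W g ω - W h ω) ^ 2 ∂P = ‖g - h‖ ^ 2 := by
  have e := hW.sum_smul_ae_eq Finset.univ ![1, -1] ![g, h]
  simp only [Fin.sum_univ_two, Matrix.cons_val_zero, Matrix.cons_val_one, one_smul, neg_smul,
    ← sub_eq_add_neg, one_mul, neg_mul] at e
  rw [← real_inner_self_eq_norm_sq, ← hW.covariance]
  refine integral_congr_ae ?_
  filter_upwards [e] with ω hω
  rw [hω]
  ring

variable [IsProbabilityMeasure P] {η : Ω → ℝ}

/-- From `|exp(ia) - exp(ib)| ≤ |a - b|` and Cauchy–Schwarz. The Lipschitz bound carries the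
vanishing from finite combinations of the basis to all of `U`. -/
theorem IsGaussianNoise.norm_integral_exp_sub_le (hW : IsGaussianNoise W P) (hη : MemLp η 2 P)
    (g h : U) :
    ‖∫ ω, Complex.exp (W g ω * Complex.I) * η ω ∂P -
      ∫ ω, Complex.exp (W h ω * Complex.I) * η ω ∂P‖ ≤ √(∫ ω, η ω ^ 2 ∂P) * ‖g - h‖ := by
  have hi : ∀ a : U, Integrable (fun ω => Complex.exp (W a ω * Complex.I) * η ω) P := fun a => by
    have hm := hW.measurable a
    refine (hη.integrable (by simp)).ofReal.bdd_mul (c := 1) (by fun_prop)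
      (ae_of_all _ fun ω => ?_)
    rw [Complex.norm_exp_ofReal_mul_I]
  rw [← integral_sub (hi g) (hi h)]
  have hsub : MemLp (fun ω => W g ω - W h ω) 2 P :=
    (hW.memLp g 2 (by simp)).sub (hW.memLp h 2 (by simp))
  calc _ ≤ ∫ ω, ‖η ω‖ * ‖W g ω - W h ω‖ ∂P := by
        refine norm_integral_le_of_norm_le (hη.norm.integrable_mul hsub.norm)
          (ae_of_all _ fun ω => ?_)
        rw [← sub_mul, norm_mul, mul_comm, Complex.norm_real]
        refine mul_le_mul_of_nonneg_left ?_ (norm_nonneg _)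
        have := Real.norm_exp_I_mul_ofReal_sub_one_le (x := W g ω - W h ω)
        refine le_trans (le_of_eq ?_) this
        have e : Complex.exp (W g ω * Complex.I) - Complex.exp (W h ω * Complex.I) =
            Complex.exp (W h ω * Complex.I) *
              (Complex.exp (Complex.I * (W g ω - W h ω : ℝ)) - 1) := by
          rw [mul_sub, ← Complex.exp_add, mul_one]
          push_cast
          ring_nf
        rw [e, norm_mul, Complex.norm_exp_ofReal_mul_I, one_mul]
    _ ≤ √(∫ ω, η ω ^ 2 ∂P) * √(∫ ω, (W g ω - W h ω) ^ 2 ∂P) := by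
        have := integral_mul_norm_le_Lp_mul_Lq (μ := P) (p := 2) (q := 2) (f := η)
          (g := fun ω => W g ω - W h ω) (by norm_num [Real.holderConjugate_iff])
          (by simpa using hη) (by simpa using hsub)
        simpa [Real.sqrt_eq_rpow] using this
    _ = _ := by rw [hW.integral_sub_sq, Real.sqrt_sq (norm_nonneg _)]

variable {ι : Type*} (u : HilbertBasis ι ℝ U)

theorem IsGaussianNoise.integral_span_eq_zero (hW : IsGaussianNoise W P) (hη : MemLp η 2 P)
    (h0 : ∀ α, ∫ ω, xi W u α ω * η ω ∂P = 0) {q : Ω → ℝ}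
    (hq : q ∈ Submodule.span ℝ (Set.range (xi W u))) :
    Integrable (fun ω => q ω * η ω) P ∧ ∫ ω, q ω * η ω ∂P = 0 := by
  induction hq using Submodule.span_induction with
  | mem q hq =>
    obtain ⟨α, rfl⟩ := hq
    exact ⟨(hW.memLp_xi u α 2 (by simp)).integrable_mul hη, h0 α⟩
  | zero => simp
  | add p q _ _ hp hq =>
    simp only [Pi.add_apply, add_mul]
    exact ⟨hp.1.add hq.1, by rw [integral_add hp.1 hq.1, hp.2, hq.2, add_zero]⟩
  | smul c q _ hq =>
    simp only [Pi.smul_apply, smul_eq_mul, mul_assoc]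
    exact ⟨hq.1.const_mul c, by rw [integral_const_mul, hq.2, mul_zero]⟩

theorem IsGaussianNoise.integral_exp_sum_eq_zero (hW : IsGaussianNoise W P) (hη : MemLp η 2 P)
    (h0 : ∀ α, ∫ ω, xi W u α ω * η ω ∂P = 0) (s : Finset ι) (c : ι → ℝ) :
    ∫ ω, Complex.exp (W (∑ k ∈ s, c k • u k) ω * Complex.I) * η ω ∂P = 0 := by
  set h := ∑ k ∈ s, c k • u k with hh
  have hm := hW.measurable h
  have hpow : ∀ n : ℕ, Integrable (fun ω => W h ω ^ n * η ω) P ∧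
      ∫ ω, W h ω ^ n * η ω ∂P = 0 := fun n => by
    have h1 := hW.integral_span_eq_zero u hη h0 (sum_pow_mem_span_xi u W s c n)
    have e : (fun ω => ((∑ k ∈ s, c k • W (u k)) ^ n) ω * η ω) =ᵐ[P]
        fun ω => W h ω ^ n * η ω := by
      filter_upwards [hW.sum_smul_ae_eq s c fun k => u k] with ω hω
      rw [hω]
      simp
    exact ⟨h1.1.congr e, (integral_congr_ae e).symm.trans h1.2⟩
  have hexp : ∀ ω, HasSum (fun n : ℕ => |W h ω| ^ n / n.factorial * |η ω|)
      (Real.exp |W h ω| * |η ω|) := fun ω => by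
    rw [Real.exp_eq_exp_ℝ]
    exact (NormedSpace.expSeries_div_hasSum_exp (𝔸 := ℝ) |W h ω|).mul_right |η ω|
  -- The exponential is integrated termwise against `η`, dominated by `exp |W h| |η|`, a product of
  -- two square-integrable functions. Each term is a multiple of `E((W h)^n η) = 0`.
  have key := hasSum_integral_of_dominated_convergence (μ := P)
    (F := fun (n : ℕ) ω => (W h ω * Complex.I) ^ n / n.factorial * (η ω : ℂ))
    (f := fun ω => Complex.exp (W h ω * Complex.I) * η ω)
    (fun n ω => |W h ω| ^ n / n.factorial * |η ω|)
    (fun n => by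
      have := hη.1.aemeasurable
      exact AEMeasurable.aestronglyMeasurable (by fun_prop))
    (fun n => ae_of_all _ fun ω => by simp)
    (ae_of_all _ fun ω => (hexp ω).summable)
    (((hW.memLp_exp_abs h).integrable_mul hη.abs).congr
      (ae_of_all _ fun ω => (hexp ω).tsum_eq.symm))
    (ae_of_all _ fun ω => by
      rw [Complex.exp_eq_exp_ℂ]
      exact (NormedSpace.expSeries_div_hasSum_exp (𝔸 := ℂ) (W h ω * Complex.I)).mul_right (η ω : ℂ))
  refine key.unique ?_
  convert hasSum_zero with n
  have e : ∀ ω, (W h ω * Complex.I) ^ n / n.factorial * (η ω : ℂ) =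
      (Complex.I ^ n / n.factorial) * ((W h ω ^ n * η ω : ℝ) : ℂ) := fun ω => by
    push_cast
    ring
  simp only [e]
  rw [integral_const_mul, integral_complex_ofReal, (hpow n).2]
  simp

theorem IsGaussianNoise.integral_exp_eq_zero (hW : IsGaussianNoise W P) (hη : MemLp η 2 P)
    (h0 : ∀ α, ∫ ω, xi W u α ω * η ω ∂P = 0) (h : U) :
    ∫ ω, Complex.exp (W h ω * Complex.I) * η ω ∂P = 0 := by
  have hc : Continuous fun h : U => ∫ ω, Complex.exp (W h ω * Complex.I) * η ω ∂P :=
    (LipschitzWith.of_dist_le_mul (K := ⟨√(∫ ω, η ω ^ 2 ∂P), Real.sqrt_nonneg _⟩) fun g h => by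
      rw [dist_eq_norm, dist_eq_norm]
      exact hW.norm_integral_exp_sub_le hη g h).continuous
  have ht := (u.hasSum_repr h)
  have := (hc.tendsto h).comp ht
  refine tendsto_nhds_unique this (tendsto_const_nhds.congr fun s => ?_)
  exact (hW.integral_exp_sum_eq_zero u hη h0 s _).symm

end CharFun

/-! ### Completeness of the chaos -/

section Completeness

variable {Ω : Type*} [MeasurableSpace Ω] {P : Measure Ω}

theorem integral_withDensity_ofReal {E : Type*} [NormedAddCommGroup E] [NormedSpace ℝ E]
    {φ : Ω → ℝ} (hφ : Measurable φ) (g : Ω → E) :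
    ∫ ω, g ω ∂(P.withDensity fun ω => ENNReal.ofReal (φ ω)) = ∫ ω, max (φ ω) 0 • g ω ∂P := by
  rw [integral_withDensity_eq_integral_toReal_smul hφ.ennreal_ofReal
    (ae_of_all _ fun _ => ENNReal.ofReal_lt_top)]
  simp [ENNReal.toReal_ofReal']

variable {U : Type*} [IsProbabilityMeasure P] [NormedAddCommGroup U] [InnerProductSpace ℝ U]
  {W : U → Ω → ℝ} {η : Ω → ℝ}

/-- A square-integrable random variable which is orthogonal to all the complex exponentials of the
noise is zero. -/
theorem IsGaussianNoise.ae_eq_zero_of_integral_exp (hW : IsGaussianNoise W P) (hη : MemLp η 2 P)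
    (h0 : ∀ h, ∫ ω, Complex.exp (W h ω * Complex.I) * η ω ∂P = 0) : η =ᵐ[P] 0 := by
  classical
  wlog hm : Measurable η generalizing η
  · have e := hη.1.aemeasurable.ae_eq_mk
    refine e.trans (this (hη.ae_eq e) (fun h => ?_) hη.1.aemeasurable.measurable_mk)
    rw [← h0 h]
    refine integral_congr_ae ?_
    filter_upwards [e] with ω hω
    rw [hω]
  have hint := hη.integrable (by simp : (1 : ℝ≥0∞) ≤ 2)
  -- As `ENNReal.ofReal` truncates at zero, `μ` and `ν` have densities `η⁺` and `η⁻`; the goal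
  -- becomes `μ = ν`.
  let μ : Measure Ω := P.withDensity fun ω => ENNReal.ofReal (η ω)
  let ν : Measure Ω := P.withDensity fun ω => ENNReal.ofReal (-η ω)
  have : IsFiniteMeasure μ := isFiniteMeasure_withDensity_ofReal hint.2
  have : IsFiniteMeasure ν := isFiniteMeasure_withDensity_ofReal hint.neg.2
  let T : Ω → U → ℝ := fun ω h => W h ω
  have hT : Measurable T := measurable_pi_lambda _ hW.measurable
  have hchar : ∀ h, ∫ ω, Complex.exp (W h ω * Complex.I) ∂μ =
      ∫ ω, Complex.exp (W h ω * Complex.I) ∂ν := fun h => by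
    have hmh := hW.measurable h
    have hi : ∀ φ : Ω → ℝ, Integrable φ P →
        Integrable (fun ω => max (φ ω) 0 • Complex.exp (W h ω * Complex.I)) P := fun φ hφ => by
      refine hφ.pos_part.smul_of_top_left ?_
      refine memLp_top_of_bound (by fun_prop) 1 (ae_of_all _ fun ω => ?_)
      rw [Complex.norm_exp_ofReal_mul_I]
    have hν : ν = P.withDensity fun ω => ENNReal.ofReal ((-η) ω) := rfl
    rw [hν, integral_withDensity_ofReal hm, integral_withDensity_ofReal hm.neg, ← sub_eq_zero,
      ← integral_sub (hi _ hint) (hi _ hint.neg), ← h0 h]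
    refine integral_congr_ae (ae_of_all _ fun ω => ?_)
    simp only [← sub_smul, Pi.neg_apply]
    rw [max_zero_sub_max_neg_zero_eq_self, Complex.real_smul, mul_comm]
  have hfin : ∀ I : Finset U, (μ.map T).map I.restrict = (ν.map T).map I.restrict := fun I => by
    refine Measure.ext_of_charFunDual ?_
    ext L
    -- Almost sure linearity turns a functional of finitely many noise variables into a single `W
    -- h`; absolute continuity transfers the null set to `ρ`.
    have hL : ∀ ρ : Measure Ω, ρ ≪ P → charFunDual ((ρ.map T).map I.restrict) L =
        ∫ ω, Complex.exp (W (∑ h : I, L (Pi.single h 1) • (h : U)) ω * Complex.I) ∂ρ :=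
      fun ρ hρ => by
        rw [charFunDual_apply, Measure.map_map (Finset.measurable_restrict I) hT, integral_map
          ((Finset.measurable_restrict I).comp hT).aemeasurable (by fun_prop)]
        refine integral_congr_ae ?_
        filter_upwards [hρ (hW.sum_smul_ae_eq Finset.univ (fun h : I => L (Pi.single h 1))
          fun h => (h : U))] with ω hω
        rw [hω]
        congr 3
        conv_lhs => rw [← Finset.univ_sum_single ((I.restrict ∘ T) ω), map_sum]
        refine Finset.sum_congr rfl fun h _ => ?_
        have e : Pi.single h ((I.restrict ∘ T) ω h) =
            W h ω • (Pi.single h 1 : I → ℝ) := by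
          rw [← Pi.single_smul, smul_eq_mul, mul_one]
          rfl
        rw [e, map_smul, smul_eq_mul, mul_comm]
    rw [hL μ (withDensity_absolutelyContinuous _ _), hL ν (withDensity_absolutelyContinuous _ _),
      hchar]
  have hmap : μ.map T = ν.map T := by
    refine IsProjectiveLimit.unique (P := fun I => (ν.map T).map I.restrict) hfin fun I => rfl
  have heq : μ = ν := by
    refine Measure.ext fun s hs => ?_
    -- Up to a null set, `s` is the preimage under `T` of a measurable set, on which the two laws of
    -- the noise agree.
    obtain ⟨t, ht, hst⟩ := hW.generates s hs
    have ht' : MeasurableSet[MeasurableSpace.pi.comap T] t := by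
      convert ht using 1
      simp only [MeasurableSpace.pi, MeasurableSpace.comap_iSup, MeasurableSpace.comap_comp]
      rfl
    obtain ⟨A, hA, rfl⟩ := ht'
    rw [measure_congr ((withDensity_absolutelyContinuous P _).ae_eq hst : s =ᵐ[μ] T ⁻¹' A),
      measure_congr ((withDensity_absolutelyContinuous P _).ae_eq hst : s =ᵐ[ν] T ⁻¹' A),
      ← Measure.map_apply hT hA, hmap, Measure.map_apply hT hA]
  have hae := (withDensity_eq_iff_of_sigmaFinite hm.ennreal_ofReal.aemeasurable
    hm.neg.ennreal_ofReal.aemeasurable).1 heq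
  filter_upwards [hae] with ω hω
  have := congrArg ENNReal.toReal hω
  simp only [ENNReal.toReal_ofReal', Pi.neg_apply] at this
  rw [← max_zero_sub_max_neg_zero_eq_self (η ω), this, sub_self, Pi.zero_apply]

variable {ι : Type*} (u : HilbertBasis ι ℝ U)

/-- A square-integrable random element whose chaos coefficients vanish is zero. -/
theorem IsGaussianNoise.ae_eq_zero_of_chaosCoeff {X : Type*} [NormedAddCommGroup X]
    [InnerProductSpace ℝ X] [CompleteSpace X] [TopologicalSpace.SeparableSpace X]
    (hW : IsGaussianNoise W P) {ζ : Ω → X} (hζ : MemLp ζ 2 P)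
    (h0 : ∀ α, chaosCoeff P W u ζ α = 0) : ζ =ᵐ[P] 0 := by
  have : SecondCountableTopology X := UniformSpace.secondCountable_of_separable X
  refine ae_eq_zero_of_forall_inner (𝕜 := ℝ) fun x => ?_
  have hx : MemLp (fun ω => inner ℝ x (ζ ω)) 2 P := hζ.const_inner (𝕜 := ℝ) x
  refine hW.ae_eq_zero_of_integral_exp hx (hW.integral_exp_eq_zero u hx fun α => ?_)
  have hi : Integrable (fun ω => xi W u α ω • ζ ω) P :=
    (hζ.smul (hW.memLp_xi u α 2 (by simp)) (r := 1)).integrable le_rfl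
  have := integral_inner (𝕜 := ℝ) hi x
  simp only [inner_smul_right] at this
  rw [this, ← chaosCoeff, h0, inner_zero_right]

end Completeness

/-! ### The chaos expansion in `L₂(Ω; X)` -/

section Expansion

variable {Ω U ι X : Type*} [MeasurableSpace Ω] {P : Measure Ω} [NormedAddCommGroup U]
  [InnerProductSpace ℝ U] {W : U → Ω → ℝ} (u : HilbertBasis ι ℝ U)
  [NormedAddCommGroup X] [InnerProductSpace ℝ X]

theorem chaosCoeff_congr {η ζ : Ω → X} (h : η =ᵐ[P] ζ) (α : ι →₀ ℕ) :
    chaosCoeff P W u η α = chaosCoeff P W u ζ α := by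
  refine integral_congr_ae ?_
  filter_upwards [h] with ω hω
  rw [hω]

variable [IsProbabilityMeasure P]

theorem IsGaussianNoise.memLp_xi_smul (hW : IsGaussianNoise W P) (α : ι →₀ ℕ) (x : X) :
    MemLp (fun ω => xi W u α ω • x) 2 P :=
  (ContinuousLinearMap.toSpanSingleton ℝ x).comp_memLp' (hW.memLp_xi u α 2 (by simp))

theorem IsGaussianNoise.inner_toLp_xi_smul [CompleteSpace X] (hW : IsGaussianNoise W P)
    (α : ι →₀ ℕ) (x : X) (η : Lp X 2 P) :
    inner ℝ (hW.memLp_xi_smul u α x).toLp η = inner ℝ x (chaosCoeff P W u η α) := by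
  have hi : Integrable (fun ω => xi W u α ω • η ω) P :=
    ((Lp.memLp η).smul (hW.memLp_xi u α 2 (by simp)) (r := 1)).integrable le_rfl
  rw [chaosCoeff, ← integral_inner (𝕜 := ℝ) hi x, L2.inner_def]
  refine integral_congr_ae ?_
  filter_upwards [(hW.memLp_xi_smul u α x).coeFn_toLp] with ω hω
  rw [hω, inner_smul_left, inner_smul_right]
  rfl

theorem IsGaussianNoise.chaosCoeff_xi_smul [CompleteSpace X] (hW : IsGaussianNoise W P)
    [DecidableEq (ι →₀ ℕ)] (α β : ι →₀ ℕ) (x : X) :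
    chaosCoeff P W u (fun ω => xi W u β ω • x) α = if α = β then x else 0 := by
  simp only [chaosCoeff, smul_smul]
  rw [integral_smul_const, hW.integral_xi_mul_xi u]
  split_ifs <;> simp

theorem IsGaussianNoise.inner_toLp_xi_smul_toLp_xi_smul [CompleteSpace X]
    (hW : IsGaussianNoise W P) [DecidableEq (ι →₀ ℕ)] (α β : ι →₀ ℕ) (x y : X) :
    inner ℝ (hW.memLp_xi_smul u α x).toLp (hW.memLp_xi_smul u β y).toLp =
      if α = β then inner ℝ x y else 0 := by
  rw [hW.inner_toLp_xi_smul, chaosCoeff_congr u (hW.memLp_xi_smul u β y).coeFn_toLp,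
    hW.chaosCoeff_xi_smul]
  split_ifs <;> simp

/-- The isometric embedding `x ↦ ξ_α x` of `X` into `L₂(Ω; X)`. -/
noncomputable def IsGaussianNoise.chaosEmbedding [CompleteSpace X] (hW : IsGaussianNoise W P)
    (α : ι →₀ ℕ) : X →ₗᵢ[ℝ] Lp X 2 P :=
  LinearMap.isometryOfInner
    { toFun := fun x => (hW.memLp_xi_smul u α x).toLp
      map_add' := fun x y => by
        rw [← MemLp.toLp_add]
        exact MemLp.toLp_congr _ _ (ae_of_all _ fun ω => smul_add _ _ _)
      map_smul' := fun c x => by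
        rw [RingHom.id_apply, ← MemLp.toLp_const_smul]
        exact MemLp.toLp_congr _ _ (ae_of_all _ fun ω => smul_comm _ _ _) }
    fun x y => by
      classical
      exact (hW.inner_toLp_xi_smul_toLp_xi_smul u α α x y).trans (if_pos rfl)

theorem IsGaussianNoise.chaosEmbedding_apply [CompleteSpace X] (hW : IsGaussianNoise W P)
    (α : ι →₀ ℕ) (x : X) :
    hW.chaosEmbedding u α x = (hW.memLp_xi_smul u α x).toLp := rfl

theorem IsGaussianNoise.isHilbertSum_chaosEmbedding [CompleteSpace X]
    [TopologicalSpace.SeparableSpace X] (hW : IsGaussianNoise W P) :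
    IsHilbertSum ℝ (fun _ : ι →₀ ℕ => X) (hW.chaosEmbedding (X := X) u) := by
  classical
  refine IsHilbertSum.mk (fun α β hαβ x y => ?_) ?_
  · rw [hW.chaosEmbedding_apply, hW.chaosEmbedding_apply,
      hW.inner_toLp_xi_smul_toLp_xi_smul, if_neg hαβ]
  · rw [top_le_iff, Submodule.topologicalClosure_eq_top_iff, Submodule.eq_bot_iff]
    intro η hη
    refine Lp.ext ((hW.ae_eq_zero_of_chaosCoeff u (Lp.memLp η) fun α => ?_).trans
      (Lp.coeFn_zero X 2 P).symm)
    refine ext_inner_left ℝ fun x => ?_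
    rw [← hW.inner_toLp_xi_smul, inner_zero_right]
    exact (Submodule.mem_orthogonal _ _).1 hη _
      ((le_iSup (fun α => LinearMap.range (hW.chaosEmbedding (X := X) u α).toLinearMap) α) ⟨x, rfl⟩)

theorem IsGaussianNoise.hasSum_chaosEmbedding [CompleteSpace X]
    [TopologicalSpace.SeparableSpace X] (hW : IsGaussianNoise W P) (η : Lp X 2 P) :
    HasSum (fun α => hW.chaosEmbedding u α (chaosCoeff P W u η α)) η := by
  classical
  have hV := hW.isHilbertSum_chaosEmbedding (X := X) u
  obtain ⟨w, rfl⟩ := hV.linearIsometryEquiv.symm.surjective η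
  have hs := hV.hasSum_linearIsometryEquiv_symm w
  convert hs using 3 with α
  refine ext_inner_left ℝ fun x => ?_
  rw [← hW.inner_toLp_xi_smul]
  -- Pairing the abstract expansion with `ξ_α x` isolates the coordinate at `α`, which is therefore
  -- the chaos coefficient.
  refine (hs.mapL (innerSL ℝ (hW.memLp_xi_smul u α x).toLp)).unique ?_
  have e : ∀ β, innerSL ℝ (hW.memLp_xi_smul u α x).toLp (hW.chaosEmbedding u β (w β)) =
      if β = α then inner ℝ x (w α) else 0 := fun β => by
    rw [innerSL_apply_apply, hW.chaosEmbedding_apply, hW.inner_toLp_xi_smul_toLp_xi_smul]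
    rcases eq_or_ne α β with rfl | h
    · simp
    · rw [if_neg h, if_neg h.symm]
  simp only [e]
  exact hasSum_ite_eq α (inner ℝ x (w α))

/-- The Cameron–Martin theorem: a square-integrable random element is the sum of its chaos
expansion. -/
theorem IsGaussianNoise.hasChaosExpansion [CompleteSpace X] [TopologicalSpace.SeparableSpace X]
    (hW : IsGaussianNoise W P) (η : Lp X 2 P) :
    HasChaosExpansion P W u (chaosCoeff P W u η) η := by
  have h := tendsto_iff_edist_tendsto_0.1 (hW.hasSum_chaosEmbedding u η)
  refine h.congr fun S => ?_
  rw [edist_comm, Lp.edist_def]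
  refine eLpNorm_congr_ae ?_
  have := (Finset.eventually_all S).2 fun α _ =>
    (hW.memLp_xi_smul u α (chaosCoeff P W u η α)).coeFn_toLp
  filter_upwards [this, Lp.coeFn_finsetSum S
    fun α => hW.chaosEmbedding u α (chaosCoeff P W u η α)] with ω h1 h2
  rw [Pi.sub_apply, h2, Finset.sum_apply]
  congr 1
  exact Finset.sum_congr rfl h1

end Expansion

/-! ### Wick multiplication by `ξ_k` -/

section Wick

variable {Ω U ι X : Type*} [NormedAddCommGroup U] [InnerProductSpace ℝ U]
  (u : HilbertBasis ι ℝ U)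

theorem xi_single_one (W : U → Ω → ℝ) (k : ι) : xi W u (Finsupp.single k 1) = W (u k) := by
  ext ω
  simp [xi]

variable [MeasurableSpace Ω] {P : Measure Ω} [IsProbabilityMeasure P] {W : U → Ω → ℝ}
  [NormedAddCommGroup X] [InnerProductSpace ℝ X]

theorem IsGaussianNoise.chaosCoeff_basis (hW : IsGaussianNoise W P) [DecidableEq (ι →₀ ℕ)]
    (k : ι) (α : ι →₀ ℕ) :
    chaosCoeff P W u (W (u k)) α = if α = Finsupp.single k 1 then 1 else 0 := by
  rw [← xi_single_one u W]
  exact hW.integral_xi_mul_xi u α _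

theorem multiFactorial_add_single (α : ι →₀ ℕ) (k : ι) :
    multiFactorial (α + Finsupp.single k 1) = (α k + 1) * multiFactorial α := by
  classical
  have h1 : multiFactorial (α + Finsupp.single k 1) =
      ∏ j ∈ insert k α.support, ((α + Finsupp.single k 1 : ι →₀ ℕ) j).factorial := by
    refine Finsupp.prod_of_support_subset _ (fun j hj => ?_) _ (by simp)
    rcases eq_or_ne j k with rfl | h
    · simp
    · simpa [h, Finsupp.single_apply, h.symm] using hj
  have h2 : multiFactorial α = ∏ j ∈ insert k α.support, (α j).factorial :=
    Finsupp.prod_of_support_subset _ (Finset.subset_insert _ _) _ (by simp)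
  rw [h1, h2, ← Finset.mul_prod_erase _ _ (Finset.mem_insert_self k _),
    ← Finset.mul_prod_erase _ (fun j => (α j).factorial) (Finset.mem_insert_self k _), ← mul_assoc]
  congr 1
  · simp [Nat.factorial_succ]
  · refine Finset.prod_congr rfl fun j hj => ?_
    rw [Finsupp.add_apply, Finsupp.single_eq_of_ne (Finset.ne_of_mem_erase hj), add_zero]

/-- Wick multiplication by `ξ_k` is the creation operator. -/
theorem IsGaussianNoise.wick_basis (hW : IsGaussianNoise W P) (c : (ι →₀ ℕ) → X) (k : ι)
    (α : ι →₀ ℕ) :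
    wick c (chaosCoeff P W u (W (u k))) α =
      √(α k : ℝ) • c (α - Finsupp.single k 1) := by
  classical
  rw [wick]
  simp only [hW.chaosCoeff_basis]
  -- If `α k = 0`, no decomposition of `α` contains `ε_k`, and `√0` kills the truncated index `α -
  -- ε_k`. Otherwise only `(α - ε_k, ε_k)` contributes, with weight `√(α! / (α - ε_k)!) = √α_k`.
  rcases Nat.eq_zero_or_pos (α k) with h0 | hpos
  · rw [h0]
    simp only [Nat.cast_zero, Real.sqrt_zero, zero_smul]
    refine Finset.sum_eq_zero fun p hp => ?_
    rw [if_neg, mul_zero, zero_smul]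
    intro h
    have := DFunLike.congr_fun (Finset.HasAntidiagonal.mem_antidiagonal.1 hp) k
    rw [h, Finsupp.add_apply, Finsupp.single_eq_same, h0] at this
    omega
  · have hα : α - Finsupp.single k 1 + Finsupp.single k 1 = α :=
      tsub_add_cancel_of_le (Finsupp.single_le_iff.2 hpos)
    rw [Finset.sum_eq_single (α - Finsupp.single k 1, Finsupp.single k 1)]
    · rw [if_pos rfl, mul_one]
      congr 2
      have h1 : (multiFactorial α : ℝ) = α k * multiFactorial (α - Finsupp.single k 1) := by
        conv_lhs => rw [← hα, multiFactorial_add_single]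
        simp [Nat.sub_add_cancel hpos]
      have h2 : multiFactorial (Finsupp.single k 1) = 1 := by
        rw [multiFactorial, Finsupp.prod_single_index] <;> simp
      have h3 : (multiFactorial (α - Finsupp.single k 1) : ℝ) ≠ 0 :=
        Nat.cast_ne_zero.2 (Finset.prod_ne_zero_iff.2 fun _ _ => Nat.factorial_ne_zero _)
      rw [h1, h2]
      field_simp
      simp
    · intro p hp hne
      rw [if_neg, mul_zero, zero_smul]
      intro h
      refine hne (Prod.ext ?_ h)
      have := Finset.HasAntidiagonal.mem_antidiagonal.1 hp
      rw [h] at this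
      exact eq_tsub_of_add_eq this
    · intro h
      exact absurd (Finset.HasAntidiagonal.mem_antidiagonal.2 hα) h

end Wick

end WienerChaos

theorem theorem2p2 {Ω : Type*} [MeasurableSpace Ω] (P : Measure Ω) [IsProbabilityMeasure P]
    {U : Type*} [NormedAddCommGroup U] [InnerProductSpace ℝ U] [CompleteSpace U]
    [TopologicalSpace.SeparableSpace U]
    {X : Type*} [NormedAddCommGroup X] [InnerProductSpace ℝ X] [CompleteSpace X]
    [TopologicalSpace.SeparableSpace X]
    (W : U → Ω → ℝ) (hW : WienerChaos.IsGaussianNoise W P)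
    {ι : Type*} (u : HilbertBasis ι ℝ U)
    (f : Lp (WienerChaos.HTensor X U) 2 P) (fk : ι → Lp X 2 P)
    (hf : HasSum (fun k => (WienerChaos.tensorRight (X := X) (u k)).compLp (fk k)) f)
    (δf : Lp X 2 P) (hδ : WienerChaos.IsSkorokhodIntegral P W f δf) :
    (∃ S : (ι →₀ ℕ) → X,
      WienerChaos.IsFormalSum
        (fun k => WienerChaos.wick (WienerChaos.chaosCoeff P W u (fk k))
          (WienerChaos.chaosCoeff P W u (W (u k)))) S ∧
      WienerChaos.HasChaosExpansion P W u S δf) ∧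
    ∀ α : ι →₀ ℕ,
      WienerChaos.chaosCoeff P W u δf α =
        ∑ k ∈ α.support,
          √(α k : ℝ) • WienerChaos.chaosCoeff P W u (fk k) (α - Finsupp.single k 1) := by
  have hcoeff := WienerChaos.chaosCoeff_skorokhod hW u hf hδ
  -- Taking `S` to be the coefficients of `δ f` makes convergence an instance of Cameron–Martin;
  -- only the formal sum remains to be matched.
  refine ⟨⟨WienerChaos.chaosCoeff P W u δf, fun α => ?_, hW.hasChaosExpansion u δf⟩, hcoeff⟩
  simp only [hW.wick_basis]
  have hsupp : (Function.support fun k => √(α k : ℝ) •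
      WienerChaos.chaosCoeff P W u (fk k) (α - Finsupp.single k 1)) ⊆ ↑α.support := fun k hk => by
    contrapose! hk
    simp only [Finset.mem_coe, Finsupp.mem_support_iff, not_not] at hk
    simp [hk]
  exact ⟨α.support.finite_toSet.subset hsupp,
    (finsum_eq_sum_of_support_subset _ hsupp).trans (hcoeff α).symm⟩
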